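/- Let $V=(V,Y,\mathbf 1,\omega)$ be a simple vertex operator algebra over $\mathbb C$, with finite-dimensional homogeneous subspaces $V_n$ ($n\in\mathbb Z$, $V_n=0$ for $n\ll 0$), and let $G\le \mathrm{Aut}(V)$ be a compact Lie group of automorphisms of $V$ acting continuously on $V$ (i.e. continuously on each $V_n$). Let $(W_\lambda)_{\lambda\in\Lambda}$ be a family of simple $G$-submodules of $V$, each contained in some $V_k$, pairwise non-isomorphic, and such that every simple $G$-submodule of $V$ is isomorphic to some $W_\lambda$. Put $V_\lambda=\mathrm{Hom}_G(W_\lambda,V)$, and identify $w\otimes f\in W_\lambda\otimes V_\lambda$ with $f(w)\in V$. Let $U$ be a sub vertex operator algebra of $V$ with $V^G\subset U\subset V$. Then there are unique subspaces $R_\lambda\subset W_\lambda$ such that $$U=\bigoplus_{\lambda\in\Lambda}R_\lambda\otimes V_\lambda .$$ Moreover, with $W=\bigoplus_{\lambda}W_\lambda$ (a $G$-submodule of $V$) and $R=\bigoplus_\lambda R_\lambda\subset W$, every $G$-module homomorphism $\pi: W\otimes_{\mathbb C}W\to W$ satisfies $\pi(R\otimes R)\subset R$. -/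

import Mathlib

open scoped TensorProduct DirectSum ContDiff Manifold

noncomputable section

/-- A vertex operator algebra structure on the complex vector space `V`.  The state-field map `Y`
takes values in Mathlib's vertex operators (linear maps `V → V((z))`), so that `u_n v = 0` for `n`
large is built in; `VertexOperator.ncoeff (Y u) n` is the mode `u_n` in
`Y(u,z) = ∑ u_n z^(-n-1)`. -/
structure VOA (V : Type*) [AddCommGroup V] [Module ℂ V] where
  /-- the state-field correspondence -/
  Y : V →ₗ[ℂ] VertexOperator ℂ V
  /-- the vacuum vector -/
  vac : V
  /-- the conformal vector -/
  conf : V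
  /-- the central charge -/
  charge : ℂ
  /-- the homogeneous subspaces -/
  gr : ℤ → Submodule ℂ V
  gr_internal : DirectSum.IsInternal gr
  gr_finite : ∀ n, FiniteDimensional ℂ (gr n)
  gr_bounded : ∃ N : ℤ, ∀ n < N, gr n = ⊥
  /-- `Y(1,z) = id` -/
  vac_mode : ∀ (n : ℤ) (v : V), VertexOperator.ncoeff (Y vac) n v = if n = -1 then v else 0
  /-- `Y(v,z)1` has no negative powers of `z` ... -/
  creation : ∀ (v : V) (n : ℤ), 0 ≤ n → VertexOperator.ncoeff (Y v) n vac = 0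
  /-- ... and constant term `v` -/
  creation_neg_one : ∀ v : V, VertexOperator.ncoeff (Y v) (-1) vac = v
  /-- the Jacobi identity, in components; all sums have finite support -/
  jacobi : ∀ (u v w : V) (p q r : ℤ),
    ∑ᶠ i : ℕ, Ring.choose p i •
        VertexOperator.ncoeff (Y (VertexOperator.ncoeff (Y u) (r + i) v)) (p + q - i) w =
      ∑ᶠ i : ℕ, ((-1 : ℤ) ^ i * Ring.choose r i) •
        (VertexOperator.ncoeff (Y u) (p + r - i) (VertexOperator.ncoeff (Y v) (q + i) w) -
          (Int.negOnePow r : ℤ) •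
            VertexOperator.ncoeff (Y v) (q + r - i) (VertexOperator.ncoeff (Y u) (p + i) w))
  /-- the Virasoro relations for `L(n) = ω_{n+1}` -/
  virasoro : ∀ (m n : ℤ) (v : V),
    VertexOperator.ncoeff (Y conf) (m + 1) (VertexOperator.ncoeff (Y conf) (n + 1) v) -
      VertexOperator.ncoeff (Y conf) (n + 1) (VertexOperator.ncoeff (Y conf) (m + 1) v) =
    ((m : ℂ) - n) • VertexOperator.ncoeff (Y conf) (m + n + 1) v +
      (if m + n = 0 then (((m : ℂ) ^ 3 - m) / 12 * charge) • v else 0)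
  /-- `L(0)` acts on `gr n` as `n` -/
  weight : ∀ (n : ℤ), ∀ v ∈ gr n, VertexOperator.ncoeff (Y conf) 1 v = (n : ℂ) • v
  /-- `Y(L(-1)v,z) = d/dz Y(v,z)` -/
  translation : ∀ (u v : V) (n : ℤ),
    VertexOperator.ncoeff (Y (VertexOperator.ncoeff (Y conf) 0 u)) n v =
      (-(n : ℂ)) • VertexOperator.ncoeff (Y u) (n - 1) v

namespace VOA

variable {V : Type*} [AddCommGroup V] [Module ℂ V] (A : VOA V)

/-- The mode `u_n ∈ End V`. -/
abbrev mode (u : V) (n : ℤ) : Module.End ℂ V := VertexOperator.ncoeff (A.Y u) n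

/-- `V` is simple: it is nonzero and irreducible as a module over itself. -/
def IsSimple : Prop :=
  Nontrivial V ∧ ∀ I : Submodule ℂ V, (∀ (u : V) (n : ℤ), ∀ x ∈ I, A.mode u n x ∈ I) →
    I = ⊥ ∨ I = ⊤

/-- `U` is a sub VOA (with the same vacuum and conformal vector).  It is automatically graded,
since it is stable under `L(0) = ω_1`. -/
structure IsSubVOA (U : Submodule ℂ V) : Prop where
  vac_mem : A.vac ∈ U
  conf_mem : A.conf ∈ U
  mode_mem : ∀ u ∈ U, ∀ (n : ℤ), ∀ v ∈ U, A.mode u n v ∈ U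

/-- The group `Aut(V)` of automorphisms of the vertex operator algebra. -/
def aut : Subgroup (V ≃ₗ[ℂ] V) where
  carrier := {g | g A.vac = A.vac ∧ g A.conf = A.conf ∧
    ∀ (u : V) (n : ℤ) (v : V), g (A.mode u n v) = A.mode (g u) n (g v)}
  mul_mem' := by
    rintro a b ⟨ha, ha', ha''⟩ ⟨hb, hb', hb''⟩
    exact ⟨by simp [ha, hb], by simp [ha', hb'], fun u n v => by simp [hb'', ha'']⟩
  one_mem' := ⟨rfl, rfl, fun _ _ _ => rfl⟩
  inv_mem' := by
    rintro a ⟨ha, ha', ha''⟩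
    refine ⟨?_, ?_, fun u n v => ?_⟩
    · exact (LinearEquiv.symm_apply_eq a).2 ha.symm
    · exact (LinearEquiv.symm_apply_eq a).2 ha'.symm
    · refine (LinearEquiv.symm_apply_eq a).2 ?_
      rw [ha'']
      have h : ∀ x, a (a⁻¹ x) = x := fun x => LinearEquiv.apply_symm_apply a x
      rw [h, h]

variable {A} {G : Type*} [Group G]

/-- The representation on `V` of a group acting by automorphisms of the VOA. -/
def rep (act : G →* A.aut) : Representation ℂ G V :=
  (LinearEquiv.automorphismGroup.toLinearMapMonoidHom).comp (A.aut.subtype.comp act)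

/-- The action is continuous: all matrix coefficients are continuous.  As `G` preserves the
finite-dimensional spaces `gr n`, this says that the representation on each `gr n` is
continuous. -/
def ActsContinuously [TopologicalSpace G] (act : G →* A.aut) : Prop :=
  ∀ (v : V) (f : Module.Dual ℂ V), Continuous fun g : G => f (rep act g v)

variable (act : G →* A.aut) {Λ : Type*} (W : Λ → Subrepresentation (rep act))

/-- `(W l)` is a system of representatives, inside `V`, of the simple `G`-modules occurring
in `V`, each one contained in a homogeneous subspace of `V`. -/
structure IsSystemOfSimples : Prop where
  irreducible : ∀ l, (W l).toRepresentation.IsIrreducible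
  homogeneous : ∀ l, ∃ k : ℤ, (W l).toSubmodule ≤ A.gr k
  inequivalent : ∀ l m, l ≠ m →
    IsEmpty ((W l).toRepresentation.Equiv (W m).toRepresentation)
  complete : ∀ X : Subrepresentation (rep act), X.toRepresentation.IsIrreducible →
    ∃ l, Nonempty (X.toRepresentation.Equiv (W l).toRepresentation)

/-- The multiplicity space `V_l = Hom_G(W_l, V)`. -/
abbrev MultSpace (l : Λ) : Type _ := (W l).toRepresentation.IntertwiningMap (rep act)

/-- The evaluation map `⨁ R_l ⊗ V_l → V`, `w ⊗ f ↦ f w`, for subspaces `R_l ⊆ W_l`. -/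
def evalSum (R : ∀ l, Submodule ℂ (W l).toSubmodule) :
    (⨁ l, R l ⊗[ℂ] MultSpace act W l) →ₗ[ℂ] V :=
  open Classical in
  DirectSum.toModule ℂ Λ V fun l => TensorProduct.lift <|
    LinearMap.mk₂ ℂ (fun (w : R l) (f : MultSpace act W l) => f (w : (W l).toSubmodule))
      (fun _ _ _ => by simp) (fun _ _ _ => by simp) (fun _ _ _ => rfl) (fun _ _ _ => rfl)

/-- `U = ⨁ R_l ⊗ V_l`: the evaluation map identifies `⨁ R_l ⊗ V_l` with `U`. -/
def IsDecomposition (U : Submodule ℂ V) (R : ∀ l, Submodule ℂ (W l).toSubmodule) : Prop :=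
  Function.Injective (evalSum act W R) ∧ LinearMap.range (evalSum act W R) = U

/-- The `G`-submodule `W = ⨁ W_l` of `V`. -/
def total : Subrepresentation (rep act) where
  toSubmodule := ⨆ l, (W l).toSubmodule
  apply_mem_toSubmodule g := by
    have h : (⨆ l, (W l).toSubmodule) ≤ (⨆ l, (W l).toSubmodule).comap (rep act g) :=
      iSup_le fun l x hx => Submodule.mem_iSup_of_mem l ((W l).apply_mem_toSubmodule g hx)
    exact fun v hv => h hv

/-- The subspace `R = ⨁ R_l` of `W = ⨁ W_l`. -/
def totalSub (R : ∀ l, Submodule ℂ (W l).toSubmodule) :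
    Submodule ℂ (total act W).toSubmodule :=
  ⨆ l, (R l).map (Submodule.inclusion (le_iSup (fun l => (W l).toSubmodule) l))

end VOA

end

/-! ### Density of modes in `End V`, and nondegeneracy of `Y`. -/

namespace VOA

section Density

variable {V : Type*} [AddCommGroup V] [Module ℂ V] (A : VOA V)

/-! The point is that equivariant maps are built from modes of `G`-fixed vectors, which lie in `U`.
Associativity shows that products of modes agree on finite sets with linear combinations of modes.
With Schur's lemma and Jacobson density, every endomorphism of `V` is then such a combination on any
finite set (`IsSimple.mem_localModeSpan`). Hence, for `Z` finite-dimensional and jointly injective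
`β i : Z → V`, every linear map `Z → V` is a combination of maps `a_m ∘ β i`
(`IsSimple.span_mode_comp_eq_top`). If the `β i` and the map are equivariant, Haar averaging
replaces each `a` by a vector of `V^G` (`IsSimple.mem_invModeSpan`).

For `Z = X ⊂ V` with the inclusion, this says that `U` is stable under `Hom_G(X, V)`. So `U` is
compatible with isotypic decomposition, and `R_λ = U ∩ W_λ` works; Schur orthogonality gives
directness and uniqueness. For `Z = X ⊗ Y` with `β n (u ⊗ v) = u_n v`, jointly injective by
`IsSimple.eq_zero_of_modeTensor_eq_zero`, it says that equivariant maps `X ⊗ Y → V` send `(U ∩ X) ⊗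
(U ∩ Y)` into `U`, whence the statement on `π`. -/

theorem exists_mode_eq_zero (u v : V) : ∃ k : ℕ, ∀ n : ℤ, k ≤ n → A.mode u n v = 0 := by
  refine ⟨(-(HahnSeries.order ((HahnModule.of ℂ).symm (A.Y u v)))).toNat, fun n hn => ?_⟩
  exact VertexOperator.ncoeff_eq_zero_of_lt_order _ _ _ (by omega)

theorem exists_mode_eq_zero_of_finset {ι : Type*} (s : Finset ι) (u v : ι → V) :
    ∃ k : ℕ, ∀ i ∈ s, ∀ n : ℤ, k ≤ n → A.mode (u i) n (v i) = 0 := by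
  choose k hk using fun i => A.exists_mode_eq_zero (u i) (v i)
  refine ⟨s.sup k, fun i hi n hn => hk i n (le_trans ?_ hn)⟩
  exact_mod_cast Finset.le_sup (f := k) hi

/-- The linear span of all modes. -/
def modeSpan : Submodule ℂ (Module.End ℂ V) :=
  Submodule.span ℂ (Set.range fun p : V × ℤ => A.mode p.1 p.2)

theorem mode_mem_modeSpan (u : V) (n : ℤ) : A.mode u n ∈ A.modeSpan :=
  Submodule.subset_span ⟨(u, n), rfl⟩

/-- The endomorphisms agreeing on the finite set `s` with a linear combination of modes. -/
def localModeSpan (s : Finset V) : Submodule ℂ (Module.End ℂ V) where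
  carrier := {S | ∃ T ∈ A.modeSpan, ∀ w ∈ s, S w = T w}
  add_mem' := by
    rintro S S' ⟨T, hT, h⟩ ⟨T', hT', h'⟩
    exact ⟨T + T', add_mem hT hT', fun w hw => by simp [h w hw, h' w hw]⟩
  zero_mem' := ⟨0, zero_mem _, fun _ _ => rfl⟩
  smul_mem' := by
    rintro c S ⟨T, hT, h⟩
    exact ⟨c • T, Submodule.smul_mem _ c hT, fun w hw => by simp [h w hw]⟩

variable {A} in
theorem mem_localModeSpan_of_eq {s : Finset V} {S T : Module.End ℂ V}
    (hT : T ∈ A.localModeSpan s) (h : ∀ w ∈ s, S w = T w) : S ∈ A.localModeSpan s := by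
  obtain ⟨T', hT', h'⟩ := hT
  exact ⟨T', hT', fun w hw => (h w hw).trans (h' w hw)⟩

theorem modeSpan_le_localModeSpan (s : Finset V) : A.modeSpan ≤ A.localModeSpan s :=
  fun T hT => ⟨T, hT, fun _ _ => rfl⟩

theorem ring_choose_eq_zero {k i : ℕ} (h : k < i) : Ring.choose (k : ℤ) i = 0 := by
  rw [Ring.choose_natCast, Nat.choose_eq_zero_of_lt h, Nat.cast_zero]

/-- The associativity formula: the Jacobi identity when `u_n w = 0` for `n ≥ k`. -/
theorem associativity (u v w : V) (k m : ℕ) (hu : ∀ n : ℤ, k ≤ n → A.mode u n w = 0)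
    (q r : ℤ) (hv : ∀ n : ℤ, q + m ≤ n → A.mode v n w = 0) :
    ∑ i ∈ Finset.range (k + 1), Ring.choose (k : ℤ) i •
        A.mode (A.mode u (r + i) v) (k + q - i) w =
      ∑ i ∈ Finset.range m, ((-1 : ℤ) ^ i * Ring.choose r i) •
        A.mode u (k + r - i) (A.mode v (q + i) w) := by
  have h := A.jacobi u v w k q r
  rw [finsum_eq_sum_of_support_subset (s := Finset.range (k + 1)),
    finsum_eq_sum_of_support_subset (s := Finset.range m)] at h
  · rw [h]
    refine Finset.sum_congr rfl fun i _ => ?_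
    have : A.mode u (k + i) w = 0 := hu _ (by omega)
    rw [this]
    simp
  · intro i hi
    by_contra hi'
    refine hi ?_
    have h1 : A.mode u (k + i) w = 0 := hu _ (by omega)
    have h2 : A.mode v (q + i) w = 0 := hv _ (by simp at hi'; omega)
    simp only [h1, h2]
    simp
  · intro i hi
    by_contra hi'
    refine hi ?_
    simp only
    rw [ring_choose_eq_zero (by simpa using hi'), zero_smul]

/-- Products of modes agree on finite sets with linear combinations of modes. -/
theorem mode_mul_mode_mem (s : Finset V) (u v : V) (a b : ℤ) :
    A.mode u a * A.mode v b ∈ A.localModeSpan s := by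
  obtain ⟨k, hk⟩ := A.exists_mode_eq_zero_of_finset s (fun _ => u) id
  obtain ⟨m, hm⟩ := A.exists_mode_eq_zero_of_finset s (fun _ => v) id
  simp only [id] at hk hm
  -- Descending induction on `b`: for `b ≥ m` the product kills `s`. With `r = a - k`, the `i = 0`
  -- term of associativity is `u_a v_b`; all others involve a larger mode of `v`.
  have key : ∀ j : ℕ, ∀ a b : ℤ, m ≤ b + j → A.mode u a * A.mode v b ∈ A.localModeSpan s := by
    intro j
    induction j with
    | zero =>
      intro a b hb
      exact mem_localModeSpan_of_eq (zero_mem _) fun w hw => by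
        simp [hm w hw b (by simpa using hb)]
    | succ j ih =>
      intro a b hb
      set r : ℤ := a - k
      refine mem_localModeSpan_of_eq (T := ∑ i ∈ Finset.range (k + 1), Ring.choose (k : ℤ) i •
        A.mode (A.mode u (r + i) v) (k + b - i) - ∑ i ∈ Finset.range j,
          ((-1 : ℤ) ^ (i + 1) * Ring.choose r (i + 1)) •
          (A.mode u (k + r - (i + 1 : ℕ)) * A.mode v (b + (i + 1 : ℕ)))) ?_ fun w hw => ?_
      · refine sub_mem (sum_mem fun i _ => zsmul_mem ?_ _) (sum_mem fun i _ => zsmul_mem ?_ _)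
        · exact A.modeSpan_le_localModeSpan s (A.mode_mem_modeSpan _ _)
        · exact ih _ _ (by push_cast; omega)
      · have h := A.associativity u v w k (j + 1) (hk w hw) b r fun n hn =>
          hm w hw n (by push_cast at hn hb; omega)
        rw [Finset.sum_range_succ' _ j] at h
        simp only [LinearMap.sub_apply, LinearMap.sum_apply, LinearMap.smul_apply,
          Module.End.mul_apply]
        rw [h, add_sub_cancel_left]
        simp [r]
  refine key (m - b).toNat a b (by omega)

theorem modeSpan_mul_mem (s : Finset V) {S T : Module.End ℂ V} (hS : S ∈ A.modeSpan)
    (hT : T ∈ A.modeSpan) : S * T ∈ A.localModeSpan s := by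
  induction hS using Submodule.span_induction with
  | zero => simp
  | add x y _ _ hx hy => rw [add_mul]; exact add_mem hx hy
  | smul c x _ hx => rw [smul_mul_assoc]; exact Submodule.smul_mem _ _ hx
  | mem x hx =>
    obtain ⟨p, rfl⟩ := hx
    induction hT using Submodule.span_induction with
    | zero => simp
    | add x y _ _ hx hy => rw [mul_add]; exact add_mem hx hy
    | smul c x _ hx => rw [mul_smul_comm]; exact Submodule.smul_mem _ _ hx
    | mem x hx =>
      obtain ⟨p', rfl⟩ := hx
      exact A.mode_mul_mode_mem s _ _ _ _

theorem mode_vac_neg_one : A.mode A.vac (-1) = 1 := by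
  ext v
  exact (A.vac_mode (-1) v).trans (if_pos rfl)

/-- The associative algebra generated by the modes. -/
abbrev modeAlgebra : Subalgebra ℂ (Module.End ℂ V) :=
  Algebra.adjoin ℂ (Set.range fun p : V × ℤ => A.mode p.1 p.2)

theorem mode_mem_modeAlgebra (u : V) (n : ℤ) : A.mode u n ∈ A.modeAlgebra :=
  Algebra.subset_adjoin ⟨(u, n), rfl⟩

theorem modeAlgebra_le_localModeSpan {S : Module.End ℂ V} (hS : S ∈ A.modeAlgebra)
    (s : Finset V) : S ∈ A.localModeSpan s := by
  classical
  induction hS using Algebra.adjoin_induction generalizing s with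
  | mem x hx => exact A.modeSpan_le_localModeSpan s (Submodule.subset_span hx)
  | algebraMap c =>
    rw [Algebra.algebraMap_eq_smul_one, ← A.mode_vac_neg_one]
    exact Submodule.smul_mem _ _ (A.modeSpan_le_localModeSpan s (A.mode_mem_modeSpan _ _))
  | add x y _ _ hx hy => exact add_mem (hx s) (hy s)
  | mul x y _ _ hx hy =>
    obtain ⟨T, hT, h⟩ := hy s
    -- The outer factor must be approximated on the image of `s` under the inner one, hence the
    -- induction over all `s`.
    obtain ⟨T', hT', h'⟩ := hx (s.image T)
    refine mem_localModeSpan_of_eq (A.modeSpan_mul_mem s hT' hT) fun w hw => ?_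
    simp only [Module.End.mul_apply]
    rw [h w hw, h' _ (Finset.mem_image_of_mem _ hw)]

/-- Eigenvectors of `L(0)` with distinct eigenvalues cannot mix. So any map commuting with `ω_1`,
such as an automorphism, preserves the grading. -/
theorem mem_gr_iff (n : ℤ) (v : V) : v ∈ A.gr n ↔ A.mode A.conf 1 v = (n : ℂ) • v := by
  classical
  refine ⟨A.weight n v, fun h => ?_⟩
  let _ := A.gr_internal.chooseDecomposition
  have hsum := DirectSum.sum_support_decompose A.gr v
  have hcomp : ∀ m, m ≠ n → (DirectSum.decompose A.gr v m : V) = 0 := by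
    intro m hm
    have hL : ∀ x : V, (DirectSum.decompose A.gr (A.mode A.conf 1 x) m : V) =
        (m : ℂ) • (DirectSum.decompose A.gr x m : V) := by
      intro x
      induction x using DirectSum.Decomposition.inductionOn A.gr with
      | zero => simp
      | @homogeneous i y =>
        have : A.mode A.conf 1 (y : V) = ((i : ℂ) • y : A.gr i) := A.weight i y y.2
        rw [this]
        by_cases him : i = m
        · subst him
          rw [DirectSum.decompose_coe, DirectSum.decompose_coe, DirectSum.of_eq_same,
            DirectSum.of_eq_same, Submodule.coe_smul]
        · rw [DirectSum.decompose_of_mem_ne _ (SetLike.coe_mem _) him,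
            DirectSum.decompose_of_mem_ne _ (SetLike.coe_mem _) him, smul_zero]
      | add x y hx hy => simp only [map_add, DirectSum.decompose_add, DirectSum.add_apply,
          Submodule.coe_add, hx, hy, smul_add]
    have h1 := hL v
    rw [h, DirectSum.decompose_smul, DirectSum.smul_apply, Submodule.coe_smul, ← sub_eq_zero,
      ← sub_smul, smul_eq_zero] at h1
    refine h1.resolve_left ?_
    rw [sub_eq_zero]
    exact_mod_cast hm.symm
  rw [← hsum]
  refine sum_mem fun i _ => ?_
  by_cases hi : i = n
  · subst hi; exact SetLike.coe_mem _
  · rw [hcomp i hi]; exact zero_mem _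

variable {A}

theorem IsSimple.exists_gr_ne_bot (hA : A.IsSimple) : ∃ n, A.gr n ≠ ⊥ := by
  by_contra! h
  have := hA.1
  have h1 := A.gr_internal.submodule_iSup_eq_top
  rw [iSup_eq_bot.2 h] at h1
  exact bot_ne_top h1

/-- Schur's lemma for a simple VOA. -/
theorem IsSimple.exists_eq_smul (hA : A.IsSimple) (φ : Module.End ℂ V)
    (hφ : ∀ u n v, φ (A.mode u n v) = A.mode u n (φ v)) : ∃ c : ℂ, ∀ v, φ v = c • v := by
  obtain ⟨n, hn⟩ := hA.exists_gr_ne_bot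
  have := A.gr_finite n
  have := Submodule.nontrivial_iff_ne_bot.2 hn
  have hmap : ∀ x ∈ A.gr n, φ x ∈ A.gr n := by
    intro x hx
    rw [mem_gr_iff] at hx ⊢
    rw [← hφ, hx, map_smul]
  obtain ⟨c, hc⟩ := Module.End.exists_eigenvalue (φ.restrict hmap)
  obtain ⟨x, hx, hx0⟩ := hc.exists_hasEigenvector
  rw [Module.End.mem_eigenspace_iff] at hx
  have hx' : φ x = c • (x : V) := congrArg Subtype.val hx
  refine ⟨c, ?_⟩
  -- The eigenspace of `φ` is an ideal, nonzero because `φ` has an eigenvector in the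
  -- finite-dimensional space `gr n`.
  have h := hA.2 (LinearMap.ker (φ - c • LinearMap.id)) fun u n x hx => by
    simp only [LinearMap.mem_ker, LinearMap.sub_apply, LinearMap.smul_apply, LinearMap.id_apply,
      sub_eq_zero] at hx ⊢
    rw [hφ, hx, map_smul]
  have hmem : (x : V) ∈ LinearMap.ker (φ - c • LinearMap.id) := by simp [hx']
  rcases h with h | h
  · rw [h] at hmem
    exact (hx0 (Subtype.ext (by simpa using hmem))).elim
  · intro v
    have : v ∈ LinearMap.ker (φ - c • LinearMap.id) := h ▸ Submodule.mem_top
    simpa [sub_eq_zero] using this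

theorem IsSimple.isSimpleModule_modeAlgebra (hA : A.IsSimple) :
    IsSimpleModule A.modeAlgebra V := by
  have := hA.1
  rw [isSimpleModule_iff]
  refine { eq_bot_or_eq_top := fun N => ?_ }
  have h := hA.2 (N.restrictScalars ℂ) fun u n x hx =>
    N.smul_mem ⟨A.mode u n, A.mode_mem_modeAlgebra u n⟩ hx
  simpa using h

/-- The density theorem: on finite sets, every endomorphism of a simple VOA is a linear
combination of modes. -/
theorem IsSimple.mem_localModeSpan (hA : A.IsSimple) (h : Module.End ℂ V) (s : Finset V) :
    h ∈ A.localModeSpan s := by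
  have := hA.isSimpleModule_modeAlgebra
  -- The commutant of the modes consists of scalars, so any `ℂ`-linear map is linear over it.
  let f : Module.End (Module.End A.modeAlgebra V) V :=
    { toFun := h
      map_add' := map_add h
      map_smul' := fun φ v => by
        obtain ⟨c, hc⟩ := hA.exists_eq_smul (φ.restrictScalars ℂ) fun u n v =>
          φ.map_smul ⟨A.mode u n, A.mode_mem_modeAlgebra u n⟩ v
        simp only [LinearMap.coe_restrictScalars] at hc
        simp [hc] }
  obtain ⟨r, hr⟩ := jacobson_density (R := A.modeAlgebra) f s
  exact mem_localModeSpan_of_eq (A.modeAlgebra_le_localModeSpan r.2 s) hr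

/-! ### Injectivity of `u ⊗ v ↦ Y(u,z)v` and spanning by modes. -/

variable (A) in
/-- The mode `u_n v` as a linear map on `V ⊗ V`. -/
def modeTensor (n : ℤ) : V ⊗[ℂ] V →ₗ[ℂ] V :=
  TensorProduct.lift (LinearMap.mk₂ ℂ (fun u v => A.mode u n v)
    (fun _ _ _ => by simp [mode]) (fun _ _ _ => by simp [mode]) (fun _ _ _ => by simp)
    (fun _ _ _ => by simp))

variable (A) in
@[simp]
theorem modeTensor_tmul (n : ℤ) (u v : V) : A.modeTensor n (u ⊗ₜ v) = A.mode u n v := rfl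

theorem exists_eq_sum_tmul (z : V ⊗[ℂ] V) :
    ∃ s : Finset (V × V), z = ∑ j ∈ s, j.1 ⊗ₜ[ℂ] j.2 := by
  obtain ⟨s, hs⟩ := TensorProduct.exists_finset (R := ℂ) z
  exact ⟨s, hs⟩

/-- The common kernel of the maps `u ⊗ v ↦ u_n v` is stable under the modes acting on the right
factor. -/
theorem modeTensor_lTensor_mode {z : V ⊗[ℂ] V} (hz : ∀ n, A.modeTensor n z = 0) (a : V)
    (t n : ℤ) : A.modeTensor n ((A.mode a t).lTensor V z) = 0 := by
  obtain ⟨s, rfl⟩ := exists_eq_sum_tmul z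
  simp only [map_sum, modeTensor_tmul, LinearMap.lTensor_tmul] at hz ⊢
  obtain ⟨k, hk⟩ := A.exists_mode_eq_zero_of_finset s (fun _ => a) Prod.fst
  obtain ⟨m, hm⟩ := A.exists_mode_eq_zero_of_finset s (fun _ => a) Prod.snd
  -- Descending induction on `t`, now by locality: with `r = k` the left side of Jacobi vanishes.
  -- Summed over `s`, the terms with `a` outermost vanish by `hz`, those with `i ≥ 1` by induction,
  -- leaving the wanted sum up to sign.
  have key : ∀ j : ℕ, ∀ n t : ℤ, m ≤ t + j → ∑ x ∈ s, A.mode x.1 n (A.mode a t x.2) = 0 := by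
    intro j
    induction j with
    | zero =>
      intro n t ht
      exact Finset.sum_eq_zero fun x hx => by simp [hm x hx t (by simpa using ht)]
    | succ j ih =>
      intro n t ht
      set q : ℤ := n - k
      have hx : ∀ x ∈ s, ∑ i ∈ Finset.range (k + 1), ((-1 : ℤ) ^ i * Ring.choose (k : ℤ) i) •
          (A.mode a (t + k - i) (A.mode x.1 (q + i) x.2) -
            (Int.negOnePow k : ℤ) • A.mode x.1 (q + k - i) (A.mode a (t + i) x.2)) = 0 := by
        intro x hx
        rw [← finsum_eq_sum_of_support_subset, ← A.jacobi a x.1 x.2 t q k]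
        · refine finsum_eq_zero_of_forall_eq_zero fun i => ?_
          have : A.mode a (k + i) x.1 = 0 := hk x hx _ (by omega)
          rw [this]
          simp
        · intro i hi
          by_contra hi'
          refine hi ?_
          simp only
          rw [ring_choose_eq_zero (by simpa using hi'), mul_zero, zero_smul]
      have hsum := Finset.sum_eq_zero hx
      rw [Finset.sum_comm] at hsum
      simp only [← Finset.smul_sum, Finset.sum_sub_distrib, ← map_sum, hz, map_zero, zero_sub]
        at hsum
      rw [Finset.sum_range_succ'] at hsum
      rw [Finset.sum_eq_zero, zero_add] at hsum
      · have hq : q + k - (0 : ℕ) = n := by simp [q]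
        rw [hq] at hsum
        rcases Int.units_eq_one_or (Int.negOnePow k) with h | h <;> simpa [h] using hsum
      · intro i _
        rw [ih _ _ (by push_cast at ht ⊢; omega)]
        simp
  exact key (m - t).toNat n t (by omega)

/-- For a simple VOA, the map `u ⊗ v ↦ Y(u,z)v` is injective. -/
theorem IsSimple.eq_zero_of_modeTensor_eq_zero (hA : A.IsSimple) {z : V ⊗[ℂ] V}
    (hz : ∀ n, A.modeTensor n z = 0) : z = 0 := by
  classical
  have hspan : ∀ T ∈ A.modeSpan, ∀ n, A.modeTensor n (T.lTensor V z) = 0 := by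
    intro T hT n
    induction hT using Submodule.span_induction with
    | zero => simp
    | add x y _ _ hx hy => rw [LinearMap.lTensor_add, LinearMap.add_apply, map_add, hx, hy,
        add_zero]
    | smul c x _ hx => rw [LinearMap.lTensor_smul, LinearMap.smul_apply, map_smul, hx, smul_zero]
    | mem x hx =>
      obtain ⟨p, rfl⟩ := hx
      exact modeTensor_lTensor_mode hz _ _ _
  -- Density replaces `y ↦ α(y) 1` by a combination of modes; since `u_{-1} 1 = u`, the mode `-1`
  -- then computes `(id ⊗ α) z`.
  have hα : ∀ α : Module.Dual ℂ V, TensorProduct.rid ℂ V (α.lTensor V z) = 0 := by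
    intro α
    obtain ⟨s, rfl⟩ := exists_eq_sum_tmul z
    obtain ⟨T, hT, h⟩ := hA.mem_localModeSpan (α.smulRight A.vac) (s.image Prod.snd)
    have h1 := hspan T hT (-1)
    have hv : ∀ u, A.mode u (-1) A.vac = u := A.creation_neg_one
    simp only [map_sum, LinearMap.lTensor_tmul, modeTensor_tmul, TensorProduct.rid_tmul] at h1 ⊢
    rw [← h1]
    refine Finset.sum_congr rfl fun j hj => ?_
    rw [← h j.2 (Finset.mem_image_of_mem _ hj), LinearMap.smulRight_apply, map_smul, hv]
  let b := Module.Basis.ofVectorSpace ℂ V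
  apply (TensorProduct.equivFinsuppOfBasisRight (M := V) b).injective
  rw [map_zero]
  ext i
  rw [Finsupp.zero_apply, TensorProduct.equivFinsuppOfBasisRight_apply]
  exact hα (b.coord i)

/-- If the maps `β i : Z → V` are jointly injective and `Z` is finite-dimensional, then every
linear map `Z → V` is a combination of the `a_m ∘ β i`. -/
theorem IsSimple.span_mode_comp_eq_top (hA : A.IsSimple) {Z ι : Type*} [AddCommGroup Z]
    [Module ℂ Z] [FiniteDimensional ℂ Z] (β : ι → Z →ₗ[ℂ] V)
    (hβ : ∀ z, (∀ i, β i z = 0) → z = 0) :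
    Submodule.span ℂ {φ : Z →ₗ[ℂ] V | ∃ a m i, φ = A.mode a m ∘ₗ β i} = ⊤ := by
  classical
  set S := Submodule.span ℂ {φ : Z →ₗ[ℂ] V | ∃ a m i, φ = A.mode a m ∘ₗ β i}
  have hmode : ∀ T ∈ A.modeSpan, ∀ i, T ∘ₗ β i ∈ S := by
    intro T hT i
    induction hT using Submodule.span_induction with
    | zero => simp
    | add x y _ _ hx hy => rw [LinearMap.add_comp]; exact add_mem hx hy
    | smul c x _ hx => rw [LinearMap.smul_comp]; exact Submodule.smul_mem _ _ hx
    | mem x hx =>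
      obtain ⟨p, rfl⟩ := hx
      exact Submodule.subset_span ⟨_, _, _, rfl⟩
  let b := Module.finBasis ℂ Z
  have hend : ∀ (h : Module.End ℂ V) i, h ∘ₗ β i ∈ S := by
    intro h i
    obtain ⟨T, hT, hTh⟩ := hA.mem_localModeSpan h (Finset.univ.image fun j => β i (b j))
    have : h ∘ₗ β i = T ∘ₗ β i :=
      b.ext fun j => hTh _ (Finset.mem_image_of_mem _ (Finset.mem_univ j))
    rw [this]
    exact hmode T hT i
  -- The functionals `f ∘ β i` separate points of the finite-dimensional `Z`, so they span its dual;
  -- rank one maps, hence all maps, follow.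
  have hdual : Submodule.span ℂ {ζ : Module.Dual ℂ Z | ∃ f i, ζ = f ∘ₗ β i} = ⊤ := by
    rw [← Subspace.dualCoannihilator_dualAnnihilator_eq (W := Submodule.span ℂ _),
      Submodule.dualAnnihilator_eq_top_iff, eq_bot_iff]
    intro z hz
    rw [Submodule.mem_dualCoannihilator] at hz
    refine hβ z fun i => (Module.forall_dual_apply_eq_zero_iff ℂ _).1 fun f => ?_
    exact hz (f ∘ₗ β i) (Submodule.subset_span ⟨f, i, rfl⟩)
  have hrank : ∀ (ζ : Module.Dual ℂ Z) (y : V), ζ.smulRight y ∈ S := by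
    intro ζ y
    have hζ : ζ ∈ Submodule.span ℂ {ζ : Module.Dual ℂ Z | ∃ f i, ζ = f ∘ₗ β i} :=
      hdual ▸ Submodule.mem_top
    induction hζ using Submodule.span_induction with
    | zero => simp
    | add x x' _ _ hx hx' =>
      have : (x + x').smulRight y = x.smulRight y + x'.smulRight y := by
        ext; simp [add_smul]
      rw [this]; exact add_mem hx hx'
    | smul c x _ hx =>
      have : (c • x).smulRight y = c • x.smulRight y := by ext; simp [mul_smul]
      rw [this]; exact Submodule.smul_mem _ _ hx
    | mem x hx =>
      obtain ⟨f, i, rfl⟩ := hx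
      exact hend (f.smulRight y) i
  refine eq_top_iff.2 fun φ _ => ?_
  have : φ = ∑ j, (b.coord j).smulRight (φ (b j)) := by
    refine LinearMap.ext fun z => ?_
    conv_lhs => rw [← b.sum_repr z, map_sum]
    simp
  rw [this]
  exact sum_mem fun j _ => hrank _ _

end Density

end VOA

/-! ### Averaging over the compact group. -/

namespace VOA

section Average

variable {V : Type*} [AddCommGroup V] [Module ℂ V] {A : VOA V} {G : Type*} [Group G]
  (act : G →* A.aut)

theorem rep_mode (g : G) (u : V) (n : ℤ) (v : V) :
    rep act g (A.mode u n v) = A.mode (rep act g u) n (rep act g v) :=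
  (act g).2.2.2 u n v

theorem rep_conf (g : G) : rep act g A.conf = A.conf := (act g).2.2.1

/-- The homogeneous subspaces are `G`-stable. -/
def grSubrep (n : ℤ) : Subrepresentation (rep act) where
  toSubmodule := A.gr n
  apply_mem_toSubmodule g v hv := by
    rw [mem_gr_iff] at hv ⊢
    rw [← rep_conf act g, ← rep_mode, hv, map_smul]

theorem exists_finiteDimensional_subrep (v : V) : ∃ X : Subrepresentation (rep act),
    FiniteDimensional ℂ X.toSubmodule ∧ v ∈ X.toSubmodule := by
  have hv : v ∈ ⨆ n, A.gr n := A.gr_internal.submodule_iSup_eq_top ▸ Submodule.mem_top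
  induction hv using Submodule.iSup_induction' with
  | mem n x hx => exact ⟨grSubrep act n, A.gr_finite n, hx⟩
  | zero => exact ⟨grSubrep act 0, A.gr_finite 0, zero_mem _⟩
  | add x y _ _ hx hy =>
    obtain ⟨X, hX, hx⟩ := hx
    obtain ⟨Y, hY, hy⟩ := hy
    exact ⟨X ⊔ Y, Submodule.finiteDimensional_sup X.toSubmodule Y.toSubmodule,
      Submodule.add_mem_sup hx hy⟩

/-- The combinations of maps `a_m ∘ β i` with `a` fixed by `G`. -/
def invModeSpan {Z ι : Type*} [AddCommGroup Z] [Module ℂ Z] (β : ι → Z →ₗ[ℂ] V) :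
    Submodule ℂ (Z →ₗ[ℂ] V) :=
  Submodule.span ℂ {φ | ∃ a ∈ (rep act).invariants, ∃ m i, φ = A.mode a m ∘ₗ β i}

variable {act}

section InvModeSpan

variable {Z ι : Type*} [AddCommGroup Z] [Module ℂ Z] {β : ι → Z →ₗ[ℂ] V}

theorem invModeSpan_equivariant {ρ : Representation ℂ G Z}
    (hβ : ∀ i g z, β i (ρ g z) = rep act g (β i z)) {ψ : Z →ₗ[ℂ] V}
    (hψ : ψ ∈ invModeSpan act β) (g : G) (z : Z) : ψ (ρ g z) = rep act g (ψ z) := by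
  induction hψ using Submodule.span_induction with
  | zero => simp
  | add x y _ _ hx hy => simp [hx, hy]
  | smul c x _ hx => simp [hx]
  | mem x hx =>
    obtain ⟨a, ha, m, i, rfl⟩ := hx
    rw [LinearMap.comp_apply, LinearMap.comp_apply, rep_mode, hβ,
      ((rep act).mem_invariants a).1 ha g]

theorem invModeSpan_apply_mem {U : Submodule ℂ V} (hU : A.IsSubVOA U)
    (hGU : (rep act).invariants ≤ U) {ψ : Z →ₗ[ℂ] V} (hψ : ψ ∈ invModeSpan act β) {z : Z}
    (hz : ∀ i, β i z ∈ U) : ψ z ∈ U := by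
  induction hψ using Submodule.span_induction with
  | zero => simp
  | add x y _ _ hx hy => exact add_mem hx hy
  | smul c x _ hx => exact U.smul_mem c hx
  | mem x hx =>
    obtain ⟨a, ha, m, i, rfl⟩ := hx
    exact hU.mode_mem a (hGU ha) m _ (hz i)

end InvModeSpan

open MeasureTheory

theorem integrable_of_continuous {K : Type*} [TopologicalSpace K] [CompactSpace K]
    [MeasurableSpace K] [BorelSpace K] (μ : Measure K) [IsFiniteMeasure μ] {f : K → ℂ}
    (hf : Continuous f) : Integrable f μ :=
  hf.integrable_of_hasCompactSupport (HasCompactSupport.of_compactSpace f)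

variable [TopologicalSpace G] [IsTopologicalGroup G] [CompactSpace G]
  [MeasurableSpace G] [BorelSpace G] (μ : Measure G) [IsProbabilityMeasure μ]

/-- Averaging a vector over `G`, characterized by pairing with linear functionals. -/
theorem ActsContinuously.exists_average (hcont : ActsContinuously act) [μ.IsMulLeftInvariant]
    (v : V) : ∃ w ∈ (rep act).invariants,
      ∀ f : Module.Dual ℂ V, f w = ∫ g, f (rep act g v) ∂μ := by
  obtain ⟨X, hX, hv⟩ := exists_finiteDimensional_subrep act v
  let b := Module.finBasis ℂ X.toSubmodule
  -- Continuity is given for functionals on all of `V`, so the coordinates of `X` are extended.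
  choose c hc using fun i => LinearMap.exists_extend (b.coord i)
  have hrep : ∀ g, rep act g v = ∑ i, c i (rep act g v) • (b i : V) := by
    intro g
    have h := congrArg Subtype.val (b.sum_repr ⟨_, X.apply_mem_toSubmodule g hv⟩)
    rw [AddSubmonoidClass.coe_finsetSum] at h
    refine h.symm.trans (Finset.sum_congr rfl fun i _ => ?_)
    rw [Submodule.coe_smul, ← Module.Basis.coord_apply, ← hc i]
    rfl
  have hw : ∀ f : Module.Dual ℂ V,
      f (∑ i, (∫ g, c i (rep act g v) ∂μ) • (b i : V)) = ∫ g, f (rep act g v) ∂μ := by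
    intro f
    have : ∀ g, f (rep act g v) = ∑ i, c i (rep act g v) * f (b i) := fun g => by
      conv_lhs => rw [hrep g, map_sum]
      simp
    simp_rw [this]
    rw [integral_finsetSum _ fun i _ =>
      (integrable_of_continuous μ (hcont v (c i))).mul_const _]
    simp [integral_mul_const]
  refine ⟨_, fun g => ?_, hw⟩
  refine (Module.forall_dual_apply_eq_zero_iff ℂ _).1 (fun f => ?_) |> sub_eq_zero.1
  rw [map_sub, hw f, ← LinearMap.comp_apply, hw (f ∘ₗ rep act g), sub_eq_zero]
  simp only [LinearMap.comp_apply, ← Module.End.mul_apply, ← map_mul]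
  exact integral_mul_left_eq_self (fun h => f (rep act h v)) g

/-- Conjugating `a_m ∘ β i` by `g` gives `(g a)_m ∘ β i`, so averaging the map amounts to averaging
`a`. Continuity is carried along to make the integrals additive. -/
theorem ActsContinuously.exists_invModeSpan_average (hcont : ActsContinuously act)
    [μ.IsMulLeftInvariant] {Z ι : Type*} [AddCommGroup Z] [Module ℂ Z] {β : ι → Z →ₗ[ℂ] V}
    {ρ : Representation ℂ G Z} (hβ : ∀ i g z, β i (ρ g z) = rep act g (β i z)) {φ : Z →ₗ[ℂ] V}
    (hφ : φ ∈ Submodule.span ℂ {φ : Z →ₗ[ℂ] V | ∃ a m i, φ = A.mode a m ∘ₗ β i}) :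
    ∃ ψ ∈ invModeSpan act β, ∀ (f : Module.Dual ℂ V) (z : Z),
      Continuous (fun g => f (rep act g (φ (ρ g⁻¹ z)))) ∧
        f (ψ z) = ∫ g, f (rep act g (φ (ρ g⁻¹ z))) ∂μ := by
  induction hφ using Submodule.span_induction with
  | zero => exact ⟨0, zero_mem _, by simp [continuous_const]⟩
  | add x y _ _ hx hy =>
    obtain ⟨ψ, hψ, h⟩ := hx
    obtain ⟨ψ', hψ', h'⟩ := hy
    refine ⟨ψ + ψ', add_mem hψ hψ', fun f z => ⟨?_, ?_⟩⟩
    · simp only [LinearMap.add_apply, map_add]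
      exact (h f z).1.add (h' f z).1
    · simp only [LinearMap.add_apply, map_add, (h f z).2, (h' f z).2]
      rw [integral_add (integrable_of_continuous μ (h f z).1)
        (integrable_of_continuous μ (h' f z).1)]
  | smul c x _ hx =>
    obtain ⟨ψ, hψ, h⟩ := hx
    refine ⟨c • ψ, Submodule.smul_mem _ c hψ, fun f z => ⟨?_, ?_⟩⟩
    · simp only [LinearMap.smul_apply, map_smul]
      exact (h f z).1.const_smul c
    · simp only [LinearMap.smul_apply, map_smul, (h f z).2]
      rw [integral_smul]
  | mem x hx =>
    obtain ⟨a, m, i, rfl⟩ := hx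
    obtain ⟨w, hw, h⟩ := hcont.exists_average μ a
    refine ⟨A.mode w m ∘ₗ β i, Submodule.subset_span ⟨w, hw, m, i, rfl⟩, fun f z => ?_⟩
    let F : Module.Dual ℂ V := f ∘ₗ A.modeTensor m ∘ₗ (TensorProduct.mk ℂ V V).flip (β i z)
    have hF : ∀ u, F u = f (A.mode u m (β i z)) := fun u => rfl
    have hg : ∀ g, f (rep act g ((A.mode a m ∘ₗ β i) (ρ g⁻¹ z))) = F (rep act g a) := by
      intro g
      rw [hF, LinearMap.comp_apply, rep_mode, ← hβ, ← Module.End.mul_apply, ← map_mul,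
        mul_inv_cancel, map_one, Module.End.one_apply]
    simp only [hg]
    exact ⟨hcont a F, h F⟩

/-- Equivariant maps are given by modes of `G`-invariant vectors. -/
theorem IsSimple.mem_invModeSpan (hA : A.IsSimple) (hcont : ActsContinuously act)
    [μ.IsMulLeftInvariant] {Z ι : Type*} [AddCommGroup Z] [Module ℂ Z] [FiniteDimensional ℂ Z]
    {β : ι → Z →ₗ[ℂ] V} {ρ : Representation ℂ G Z}
    (hβ : ∀ i g z, β i (ρ g z) = rep act g (β i z)) (hβ' : ∀ z, (∀ i, β i z = 0) → z = 0)
    {φ : Z →ₗ[ℂ] V} (hφ : ∀ g z, φ (ρ g z) = rep act g (φ z)) : φ ∈ invModeSpan act β := by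
  obtain ⟨ψ, hψ, h⟩ := hcont.exists_invModeSpan_average μ hβ (φ := φ)
    (hA.span_mode_comp_eq_top β hβ' ▸ Submodule.mem_top)
  -- An equivariant map is its own average.
  have : φ = ψ := by
    refine LinearMap.ext fun z => sub_eq_zero.1 <|
      (Module.forall_dual_apply_eq_zero_iff ℂ _).1 fun f => ?_
    rw [map_sub, (h f z).2]
    simp only [← hφ, ← Module.End.mul_apply, ← map_mul, mul_inv_cancel, map_one,
      Module.End.one_apply]
    simp
  exact this ▸ hψ

/-- Averaging a linear map from a finite-dimensional submodule of `V` to `V`. -/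
theorem IsSimple.exists_intertwiningMap_average (hA : A.IsSimple) (hcont : ActsContinuously act)
    [μ.IsMulLeftInvariant] (X : Subrepresentation (rep act)) [FiniteDimensional ℂ X.toSubmodule]
    (φ : X.toSubmodule →ₗ[ℂ] V) :
    ∃ ψ : X.toRepresentation.IntertwiningMap (rep act), ∀ (f : Module.Dual ℂ V) x,
      Continuous (fun g => f (rep act g (φ (X.toRepresentation g⁻¹ x)))) ∧
        f (ψ x) = ∫ g, f (rep act g (φ (X.toRepresentation g⁻¹ x))) ∂μ := by
  have hβ : ∀ (_ : Unit) g x, X.toSubmodule.subtype (X.toRepresentation g x) =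
    rep act g (X.toSubmodule.subtype x) := fun _ _ _ => rfl
  obtain ⟨ψ, hψ, h⟩ := hcont.exists_invModeSpan_average μ hβ (φ := φ) <| by
    rw [hA.span_mode_comp_eq_top]
    · exact Submodule.mem_top
    · exact fun z hz => Subtype.ext (hz ())
  exact ⟨⟨ψ, fun g => LinearMap.ext (invModeSpan_equivariant hβ hψ g)⟩, h⟩

/-- A sub VOA containing `V^G` is preserved by equivariant maps. -/
theorem IsSimple.intertwiningMap_apply_mem (hA : A.IsSimple) (hcont : ActsContinuously act)
    [μ.IsMulLeftInvariant] {U : Submodule ℂ V} (hU : A.IsSubVOA U)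
    (hGU : (rep act).invariants ≤ U) (X : Subrepresentation (rep act))
    [FiniteDimensional ℂ X.toSubmodule] (φ : X.toRepresentation.IntertwiningMap (rep act))
    {x : X.toSubmodule} (hx : (x : V) ∈ U) : φ x ∈ U := by
  have h := hA.mem_invModeSpan μ hcont (β := fun _ : Unit => X.toSubmodule.subtype)
    (ρ := X.toRepresentation) (fun _ _ _ => rfl) (fun z hz => Subtype.ext (hz ()))
    (φ := φ.toLinearMap) φ.isIntertwining
  exact invModeSpan_apply_mem hU hGU h fun _ => hx

end Average

end VOA

/-! ### Schur orthogonality and isotypic components. -/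

namespace VOA

section Isotypic

open MeasureTheory

/-- Averages are known only through their pairings with functionals; this locates them in a
subspace. -/
theorem mem_of_forall_dual {M : Type*} [AddCommGroup M] [Module ℂ M] {p : Submodule ℂ M} {x : M}
    (h : ∀ f : Module.Dual ℂ M, (∀ y ∈ p, f y = 0) → f x = 0) : x ∈ p := by
  by_contra hx
  obtain ⟨f, hf, hp⟩ := Submodule.exists_le_ker_of_notMem hx
  exact hf (h f fun y hy => hp hy)

variable {V : Type*} [AddCommGroup V] [Module ℂ V] {A : VOA V} {G : Type*} [Group G]
  {act : G →* A.aut}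

theorem ActsContinuously.continuous_coeff [TopologicalSpace G] (hcont : ActsContinuously act)
    (X : Subrepresentation (rep act)) (α : Module.Dual ℂ X.toSubmodule) (x : X.toSubmodule) :
    Continuous fun g => α (X.toRepresentation g x) := by
  obtain ⟨f, rfl⟩ := LinearMap.exists_extend α
  exact hcont x f

section Compact

variable [TopologicalSpace G] [IsTopologicalGroup G] [CompactSpace G]
  [MeasurableSpace G] [BorelSpace G]

/-- Averaging the rank one map `x ↦ α(x) w`. -/
theorem IsSimple.exists_average_rank_one (hA : A.IsSimple) (μ : Measure G)
    [IsProbabilityMeasure μ] [μ.IsMulLeftInvariant] (hcont : ActsContinuously act)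
    (X Y : Subrepresentation (rep act)) [FiniteDimensional ℂ X.toSubmodule]
    (α : Module.Dual ℂ X.toSubmodule) (w : Y.toSubmodule) :
    ∃ ψ : X.toRepresentation.IntertwiningMap Y.toRepresentation,
      ∀ (h : Module.Dual ℂ Y.toSubmodule) x,
        h (ψ x) = ∫ g, α (X.toRepresentation g⁻¹ x) * h (Y.toRepresentation g w) ∂μ := by
  obtain ⟨ψ, hψ⟩ := hA.exists_intertwiningMap_average μ hcont X (α.smulRight (w : V))
  have hY : ∀ x, ψ x ∈ Y.toSubmodule := fun x => mem_of_forall_dual fun f hf => by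
    rw [(hψ f x).2]
    simp [hf _ (Y.apply_mem_toSubmodule _ w.2)]
  refine ⟨⟨ψ.toLinearMap.codRestrict _ hY, fun g => LinearMap.ext fun x =>
    Subtype.ext (Representation.IntertwiningMap.isIntertwining _ _ ψ g x)⟩, fun h x => ?_⟩
  obtain ⟨f, rfl⟩ := LinearMap.exists_extend h
  refine ((hψ f x).2).trans (integral_congr_ae (.of_forall fun g => ?_))
  simp only [LinearMap.smulRight_apply, map_smul]
  rfl

/-- There is an equivariant map from a finite-dimensional submodule `X` to a submodule `Y` that is
the identity on `X ∩ Y`. -/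
theorem IsSimple.exists_projection (hA : A.IsSimple) (μ : Measure G)
    [IsProbabilityMeasure μ] [μ.IsMulLeftInvariant] (hcont : ActsContinuously act)
    (X Y : Subrepresentation (rep act)) [FiniteDimensional ℂ X.toSubmodule] :
    ∃ ψ : X.toRepresentation.IntertwiningMap (rep act),
      (∀ x, ψ x ∈ Y.toSubmodule) ∧ ∀ x : X.toSubmodule, (x : V) ∈ Y.toSubmodule → ψ x = x := by
  obtain ⟨p, hp⟩ := LinearMap.exists_leftInverse_of_injective Y.toSubmodule.subtype
    Y.toSubmodule.ker_subtype
  obtain ⟨ψ, hψ⟩ := hA.exists_intertwiningMap_average μ hcont X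
    (Y.toSubmodule.subtype ∘ₗ p ∘ₗ X.toSubmodule.subtype)
  refine ⟨ψ, fun x => mem_of_forall_dual fun f hf => ?_, fun x hx => sub_eq_zero.1 <|
    (Module.forall_dual_apply_eq_zero_iff ℂ _).1 fun f => ?_⟩
  · rw [(hψ f x).2]
    simp [hf _ (Y.apply_mem_toSubmodule _ (SetLike.coe_mem _))]
  · have hpy : ∀ y ∈ Y.toSubmodule, (p y : V) = y := fun y hy =>
      congrArg Subtype.val (LinearMap.congr_fun hp ⟨y, hy⟩)
    -- Each conjugate of the linear projection `p` fixes `X ∩ Y` pointwise, hence so does the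
    -- average.
    have hg : ∀ g : G, rep act g ((Y.toSubmodule.subtype ∘ₗ p ∘ₗ X.toSubmodule.subtype)
        (X.toRepresentation g⁻¹ x)) = x := by
      intro g
      have : ((X.toRepresentation g⁻¹ x : X.toSubmodule) : V) = rep act g⁻¹ x := rfl
      simp only [LinearMap.comp_apply, Submodule.subtype_apply, this]
      rw [hpy _ (Y.apply_mem_toSubmodule _ hx), ← Module.End.mul_apply, ← map_mul,
        mul_inv_cancel, map_one, Module.End.one_apply]
    rw [map_sub, (hψ f x).2]
    simp only [hg]
    simp

end Compact

theorem exists_proper_subrep {X : Subrepresentation (rep act)} (hX : X.toSubmodule ≠ ⊥)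
    (hirr : ¬ X.toRepresentation.IsIrreducible) : ∃ Y : Subrepresentation (rep act),
      Y.toSubmodule ≠ ⊥ ∧ Y.toSubmodule < X.toSubmodule := by
  by_contra! h
  refine hirr ?_
  obtain ⟨x, hx, hx0⟩ := X.toSubmodule.exists_mem_ne_zero_of_ne_bot hX
  have hnt : Nontrivial (Subrepresentation X.toRepresentation) := by
    refine ⟨⊥, ⊤, fun h => hx0 ?_⟩
    have : (⟨x, hx⟩ : X.toSubmodule) ∈ (⊥ : Subrepresentation X.toRepresentation).toSubmodule := by
      rw [h]; exact Submodule.mem_top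
    exact congrArg Subtype.val ((Submodule.mem_bot ℂ).1 this)
  refine { eq_bot_or_eq_top := fun N => ?_ }
  let Y : Subrepresentation (rep act) :=
    { toSubmodule := N.toSubmodule.map X.toSubmodule.subtype
      apply_mem_toSubmodule := by
        rintro g _ ⟨y, hy, rfl⟩
        exact ⟨_, N.apply_mem_toSubmodule g hy, rfl⟩ }
  by_cases hY : Y.toSubmodule = ⊥
  · left
    apply Subrepresentation.toSubmodule_injective
    apply Submodule.map_injective_of_injective X.toSubmodule.injective_subtype
    exact hY.trans (Submodule.map_bot _).symm
  · right
    apply Subrepresentation.toSubmodule_injective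
    have h1 : Y.toSubmodule ≤ X.toSubmodule := Submodule.map_subtype_le _ _
    have h2 := h1.eq_of_not_lt (h Y hY)
    apply Submodule.map_injective_of_injective X.toSubmodule.injective_subtype
    exact h2.trans (Submodule.map_subtype_top X.toSubmodule).symm

variable {Λ : Type*} {W : Λ → Subrepresentation (rep act)}

theorem IsSystemOfSimples.finiteDimensional (hW : IsSystemOfSimples act W) (l : Λ) :
    FiniteDimensional ℂ (W l).toSubmodule := by
  obtain ⟨k, hk⟩ := hW.homogeneous l
  have := A.gr_finite k
  exact Submodule.finiteDimensional_of_le hk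

theorem IsSystemOfSimples.exists_ne_zero (hW : IsSystemOfSimples act W) (l : Λ) :
    ∃ w : (W l).toSubmodule, w ≠ 0 := by
  have := (hW.irreducible l).toNontrivial
  by_contra! h
  obtain ⟨N, N', hN⟩ := this
  refine hN (Subrepresentation.toSubmodule_injective ?_)
  ext x
  simp [h x]

open Classical in
theorem evalSum_lof_tmul (R : ∀ l, Submodule ℂ (W l).toSubmodule) (l : Λ)
    (w : R l) (f : MultSpace act W l) :
    evalSum act W R (DirectSum.lof ℂ Λ (fun l => R l ⊗[ℂ] MultSpace act W l) l (w ⊗ₜ f)) =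
      f (w : (W l).toSubmodule) := by
  unfold evalSum
  rw [DirectSum.toModule_lof]
  rfl

/-- The inclusion of `W l` as an element of the multiplicity space. -/
def inclMult (l : Λ) : MultSpace act W l := ⟨(W l).toSubmodule.subtype, fun _ => rfl⟩

@[simp]
theorem inclMult_apply (l : Λ) (w : (W l).toSubmodule) : inclMult (W := W) l w = (w : V) := rfl

section Compact

variable [TopologicalSpace G] [IsTopologicalGroup G] [CompactSpace G]
  [MeasurableSpace G] [BorelSpace G]

/-- Schur orthogonality, as the existence of a functional on `V` reading off the component
of type `l`. -/
theorem IsSimple.exists_schur_functional (hA : A.IsSimple) (μ : Measure G)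
    [IsProbabilityMeasure μ] [μ.IsMulLeftInvariant] (hcont : ActsContinuously act)
    (hW : IsSystemOfSimples act W) (l : Λ) (α : Module.Dual ℂ (W l).toSubmodule)
    (x : (W l).toSubmodule) (f : Module.Dual ℂ V) :
    ∃ E : Module.Dual ℂ V, (∀ (w : (W l).toSubmodule) (F : MultSpace act W l),
        E (F w) = α w * f (F x)) ∧
      ∀ m, m ≠ l → ∀ (w : (W m).toSubmodule) (F : MultSpace act W m), E (F w) = 0 := by
  have := hW.finiteDimensional l
  have := hW.irreducible l
  have hα : Continuous fun g => α ((W l).toRepresentation g⁻¹ x) :=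
    (hcont.continuous_coeff (W l) α x).comp continuous_inv
  have hint : ∀ v, Integrable (fun g => α ((W l).toRepresentation g⁻¹ x) * f (rep act g v)) μ :=
    fun v => integrable_of_continuous μ (hα.mul (hcont v f))
  let E : Module.Dual ℂ V :=
    { toFun := fun v => ∫ g, α ((W l).toRepresentation g⁻¹ x) * f (rep act g v) ∂μ
      map_add' := fun v v' => by
        simp only [map_add, mul_add]
        exact integral_add (hint v) (hint v')
      map_smul' := fun c v => by
        simp only [map_smul, smul_eq_mul, mul_left_comm _ c, RingHom.id_apply]
        exact integral_const_mul _ _ }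
  have hE : ∀ m (w : (W m).toSubmodule) (F : MultSpace act W m),
      E (F w) = ∫ g, α ((W l).toRepresentation g⁻¹ x) *
        (f ∘ₗ F.toLinearMap) ((W m).toRepresentation g w) ∂μ := by
    intro m w F
    refine integral_congr_ae (.of_forall fun g => ?_)
    simp only [LinearMap.comp_apply, Representation.IntertwiningMap.coe_toLinearMap]
    rw [F.isIntertwining]
  -- `E (F w) = f (F (ψ x))`, where `ψ` averages `y ↦ α(y) w`. For `m = l`, `ψ` is a scalar whose
  -- trace is `α w`, so the factor `dim W_l` normalizes it; for `m ≠ l`, `ψ = 0`.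
  refine ⟨(Module.finrank ℂ (W l).toSubmodule : ℂ) • E, fun w F => ?_, fun m hm w F => ?_⟩
  · obtain ⟨ψ, hψ⟩ := hA.exists_average_rank_one μ hcont (W l) (W l) α w
    obtain ⟨c, hc⟩ :=
      (Representation.IsIrreducible.algebraMap_intertwiningMap_bijective_of_isAlgClosed (k := ℂ)
        (ρ := (W l).toRepresentation)).2 ψ
    have hc' : ∀ y, ψ y = c • y := fun y => by rw [← hc]; simp
    let b := Module.finBasis ℂ (W l).toSubmodule
    have htr : (Module.finrank ℂ (W l).toSubmodule : ℂ) * c = α w := by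
      have h1 : ∑ i, b.coord i (ψ (b i)) = (Module.finrank ℂ (W l).toSubmodule : ℂ) * c := by
        simp [hc']
      rw [← h1]
      simp only [hψ]
      rw [← integral_finsetSum]
      · have : ∀ g, ∑ i, α ((W l).toRepresentation g⁻¹ (b i)) *
            b.coord i ((W l).toRepresentation g w) = α w := by
          intro g
          have h2 : α ((W l).toRepresentation g⁻¹ ((W l).toRepresentation g w)) = α w := by
            rw [← Module.End.mul_apply, ← map_mul, inv_mul_cancel, map_one, Module.End.one_apply]
          rw [← h2]
          conv_rhs => rw [← b.sum_repr ((W l).toRepresentation g w), map_sum, map_sum]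
          exact Finset.sum_congr rfl fun i _ => by simp [mul_comm]
        simp only [this]
        simp
      · exact fun i _ => integrable_of_continuous μ
          (((hcont.continuous_coeff (W l) α (b i)).comp continuous_inv).mul
            (hcont.continuous_coeff (W l) (b.coord i) w))
    rw [LinearMap.smul_apply, hE, ← hψ, hc', ← htr]
    simp [mul_assoc]
  · have := hW.irreducible m
    obtain ⟨ψ, hψ⟩ := hA.exists_average_rank_one μ hcont (W l) (W m) α w
    have := hW.inequivalent l m hm.symm
    have h0 : ψ = 0 := Subsingleton.elim _ _
    rw [LinearMap.smul_apply, hE, ← hψ, h0]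
    simp

/-- Schur functionals, taken for extensions to `W l` of the coordinates of `R l`, recover every
coefficient of `z` from its image. -/
theorem IsSimple.evalSum_injective (hA : A.IsSimple) (μ : Measure G)
    [IsProbabilityMeasure μ] [μ.IsMulLeftInvariant] (hcont : ActsContinuously act)
    (hW : IsSystemOfSimples act W) (R : ∀ l, Submodule ℂ (W l).toSubmodule) :
    Function.Injective (evalSum act W R) := by
  classical
  intro z z' hz
  ext l : 1
  let b := Module.Basis.ofVectorSpace ℂ (R l)
  apply (TensorProduct.equivFinsuppOfBasisLeft (N := MultSpace act W l) b).injective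
  ext i : 1
  rw [TensorProduct.equivFinsuppOfBasisLeft_apply, TensorProduct.equivFinsuppOfBasisLeft_apply]
  obtain ⟨α, hα⟩ := LinearMap.exists_extend (b.coord i)
  refine Representation.IntertwiningMap.ext (LinearMap.ext fun x => ?_)
  refine (Module.forall_dual_apply_eq_zero_iff ℂ _).1 (fun f => ?_) |> sub_eq_zero.1
  obtain ⟨E, hE, hE'⟩ := hA.exists_schur_functional μ hcont hW l α x f
  let ev : MultSpace act W l →ₗ[ℂ] V :=
    { toFun := fun F => F x, map_add' := fun _ _ => rfl, map_smul' := fun _ _ => rfl }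
  have key : E ∘ₗ evalSum act W R = f ∘ₗ ev ∘ₗ (TensorProduct.lid ℂ _).toLinearMap ∘ₗ
      (b.coord i).rTensor _ ∘ₗ DirectSum.component ℂ Λ _ l := by
    refine DirectSum.linearMap_ext ℂ fun m => TensorProduct.ext' fun w F => ?_
    simp only [LinearMap.comp_apply, evalSum_lof_tmul]
    by_cases hm : m = l
    · subst hm
      rw [hE, DirectSum.component.lof_self, LinearMap.rTensor_tmul]
      have : b.coord i w = α w := by rw [← hα]; rfl
      simp [ev, this]
    · rw [hE' m hm]
      have : DirectSum.component ℂ Λ (fun l => R l ⊗[ℂ] MultSpace act W l) l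
          (DirectSum.lof ℂ Λ _ m (w ⊗ₜ[ℂ] F)) = 0 := by
        rw [DirectSum.component.of, dif_neg hm]
      rw [this]
      simp
  have h : (E ∘ₗ evalSum act W R) z = (E ∘ₗ evalSum act W R) z' := congrArg E hz
  rw [key] at h
  rw [map_sub, sub_eq_zero]
  exact h

/-- If an element of `⨁ W l` lies in the image of `⨁ R l ⊗ V_l`, then its components lie in the
subspaces `R l`. -/
theorem IsSimple.mem_of_sum_mem_range_evalSum (hA : A.IsSimple) (μ : Measure G)
    [IsProbabilityMeasure μ] [μ.IsMulLeftInvariant] (hcont : ActsContinuously act)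
    (hW : IsSystemOfSimples act W) (R : ∀ l, Submodule ℂ (W l).toSubmodule) (s : Finset Λ)
    (y : ∀ l, (W l).toSubmodule)
    (hy : ∑ l ∈ s, (y l : V) ∈ LinearMap.range (evalSum act W R)) {l : Λ} (hl : l ∈ s) :
    y l ∈ R l := by
  classical
  obtain ⟨z, hz⟩ := hy
  refine mem_of_forall_dual fun α hα => ?_
  obtain ⟨x, hx⟩ := hW.exists_ne_zero l
  obtain ⟨f, hf⟩ : ∃ f : Module.Dual ℂ V, f x ≠ 0 := by
    by_contra! h
    exact hx (Subtype.ext ((Module.forall_dual_apply_eq_zero_iff ℂ _).1 h))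
  obtain ⟨E, hE, hE'⟩ := hA.exists_schur_functional μ hcont hW l α x f
  -- As `α` kills `R l`, `E` kills the image; but `E` takes the value `α (y l) * f x` on the given
  -- sum, and `f x ≠ 0`.
  have key : E ∘ₗ evalSum act W R = 0 := by
    refine DirectSum.linearMap_ext ℂ fun m => TensorProduct.ext' fun w F => ?_
    simp only [LinearMap.comp_apply, evalSum_lof_tmul]
    by_cases hm : m = l
    · subst hm
      rw [hE, hα _ w.2]
      simp
    · rw [hE' m hm]
      simp
  have h := LinearMap.congr_fun key z
  rw [LinearMap.comp_apply, hz, map_sum, Finset.sum_eq_single_of_mem l hl] at h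
  · rw [← inclMult_apply, hE] at h
    exact (mul_eq_zero.1 h).resolve_right hf
  · intro m _ hm
    rw [← inclMult_apply, hE' m hm]

/-! ### The decomposition of `U` and stability under `π`. -/

/-- The intersections `U ∩ W l`. -/
abbrev interSub (W : Λ → Subrepresentation (rep act)) (U : Submodule ℂ V) (l : Λ) :
    Submodule ℂ (W l).toSubmodule := U.comap (W l).toSubmodule.subtype

variable {U : Submodule ℂ V}

/-- Induction on `dim X`. If `X` is irreducible, transport `u` to some `W l` and back; otherwise
split `u` by an equivariant projection. The pieces stay in `U` because equivariant maps preserve it.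
-/
theorem IsSimple.mem_range_evalSum_interSub (hA : A.IsSimple) (μ : Measure G)
    [IsProbabilityMeasure μ] [μ.IsMulLeftInvariant] (hcont : ActsContinuously act)
    (hW : IsSystemOfSimples act W) (hU : A.IsSubVOA U) (hGU : (rep act).invariants ≤ U)
    (X : Subrepresentation (rep act)) (hX : FiniteDimensional ℂ X.toSubmodule) (u : V)
    (huX : u ∈ X.toSubmodule) (hu : u ∈ U) :
    u ∈ LinearMap.range (evalSum act W (interSub W U)) := by
  classical
  induction hn : Module.finrank ℂ X.toSubmodule using Nat.strong_induction_on
    generalizing X u with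
  | _ n ih =>
  by_cases hX0 : X.toSubmodule = ⊥
  · rw [hX0, Submodule.mem_bot] at huX
    rw [huX]
    exact zero_mem _
  by_cases hirr : X.toRepresentation.IsIrreducible
  · obtain ⟨l, ⟨e⟩⟩ := hW.complete X hirr
    have he : ((e ⟨u, huX⟩ : (W l).toSubmodule) : V) ∈ U :=
      hA.intertwiningMap_apply_mem μ hcont hU hGU X
        ((inclMult l).comp e.toIntertwiningMap) (x := ⟨u, huX⟩) hu
    let i : X.toRepresentation.IntertwiningMap (rep act) := ⟨X.toSubmodule.subtype, fun _ => rfl⟩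
    refine ⟨DirectSum.lof ℂ Λ (fun l => interSub W U l ⊗[ℂ] MultSpace act W l) l
      ((⟨e ⟨u, huX⟩, he⟩ : interSub W U l) ⊗ₜ i.comp e.symm.toIntertwiningMap), ?_⟩
    rw [evalSum_lof_tmul]
    change ((e.symm (e ⟨u, huX⟩) : X.toSubmodule) : V) = u
    rw [Representation.Equiv.symm_apply_apply]
  · obtain ⟨Y, hY0, hYX⟩ := exists_proper_subrep hX0 hirr
    obtain ⟨ψ, hψY, hψ⟩ := hA.exists_projection μ hcont X Y
    let K : Subrepresentation (rep act) :=
      { toSubmodule := ψ.ker.toSubmodule.map X.toSubmodule.subtype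
        apply_mem_toSubmodule := by
          rintro g _ ⟨y, hy, rfl⟩
          exact ⟨_, ψ.ker.apply_mem_toSubmodule g hy, rfl⟩ }
    -- `ψ` is the identity on `Y ≠ 0`, so its kernel is proper.
    have hKX : K.toSubmodule < X.toSubmodule := by
      refine lt_of_le_of_ne (Submodule.map_subtype_le _ _) fun h => hY0 ?_
      rw [eq_bot_iff]
      intro y hy
      obtain ⟨x, hx, rfl⟩ : y ∈ K.toSubmodule := h ▸ hYX.le hy
      have := hψ x hy
      rw [(show ψ x = 0 from hx)] at this
      exact (Submodule.mem_bot ℂ).2 this.symm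
    have hψu : ψ ⟨u, huX⟩ ∈ U :=
      hA.intertwiningMap_apply_mem μ hcont hU hGU X ψ (x := ⟨u, huX⟩) hu
    have hfY := Submodule.finiteDimensional_of_le hYX.le
    have hfK := Submodule.finiteDimensional_of_le hKX.le
    have h1 := ih _ (hn ▸ Submodule.finrank_lt_finrank_of_lt hYX) Y hfY _ (hψY ⟨u, huX⟩) hψu rfl
    have h2 := ih _ (hn ▸ Submodule.finrank_lt_finrank_of_lt hKX) K hfK (u - ψ ⟨u, huX⟩)
      ⟨⟨u, huX⟩ - ⟨ψ ⟨u, huX⟩, hYX.le (hψY _)⟩, by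
        change ψ (_ - _) = 0
        rw [map_sub, hψ ⟨ψ ⟨u, huX⟩, hYX.le (hψY _)⟩ (hψY _), sub_self], rfl⟩
      (sub_mem hu hψu) rfl
    simpa using add_mem h1 h2

theorem IsSimple.isDecomposition_interSub (hA : A.IsSimple) (μ : Measure G)
    [IsProbabilityMeasure μ] [μ.IsMulLeftInvariant] (hcont : ActsContinuously act)
    (hW : IsSystemOfSimples act W) (hU : A.IsSubVOA U) (hGU : (rep act).invariants ≤ U) :
    IsDecomposition act W U (interSub W U) := by
  classical
  refine ⟨hA.evalSum_injective μ hcont hW _, le_antisymm ?_ fun u hu => ?_⟩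
  · rintro _ ⟨z, rfl⟩
    have hzero : U.mkQ ∘ₗ evalSum act W (interSub W U) = 0 := by
      refine DirectSum.linearMap_ext ℂ fun l => TensorProduct.ext' fun w F => ?_
      have := hW.finiteDimensional l
      simp only [LinearMap.comp_apply, evalSum_lof_tmul]
      exact (Submodule.Quotient.mk_eq_zero U).2
        (hA.intertwiningMap_apply_mem μ hcont hU hGU (W l) F w.2)
    exact (Submodule.Quotient.mk_eq_zero U).1 (LinearMap.congr_fun hzero z)
  · obtain ⟨X, hX, huX⟩ := exists_finiteDimensional_subrep act u
    exact hA.mem_range_evalSum_interSub μ hcont hW hU hGU X hX u huX hu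

/-- The inclusion of `W l` belongs to `V_l`, so `R l ⊆ U`; the converse is Schur separation of
components. -/
theorem IsSimple.eq_interSub (hA : A.IsSimple) (μ : Measure G)
    [IsProbabilityMeasure μ] [μ.IsMulLeftInvariant] (hcont : ActsContinuously act)
    (hW : IsSystemOfSimples act W) {R : ∀ l, Submodule ℂ (W l).toSubmodule}
    (hR : IsDecomposition act W U R) : R = interSub W U := by
  classical
  funext l
  ext w
  refine ⟨fun hw => ?_, fun hw => ?_⟩
  · change (w : V) ∈ U
    rw [← hR.2]
    exact ⟨DirectSum.lof ℂ Λ (fun l => R l ⊗[ℂ] MultSpace act W l) l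
      ((⟨w, hw⟩ : R l) ⊗ₜ inclMult l), evalSum_lof_tmul R l ⟨w, hw⟩ (inclMult l)⟩
  · have h := hA.mem_of_sum_mem_range_evalSum μ hcont hW R {l} (Pi.single l w)
      (by simpa [hR.2] using hw) (Finset.mem_singleton_self l)
    simpa using h

theorem IsSimple.mem_totalSub_interSub (hA : A.IsSimple) (μ : Measure G)
    [IsProbabilityMeasure μ] [μ.IsMulLeftInvariant] (hcont : ActsContinuously act)
    (hW : IsSystemOfSimples act W) (hR : IsDecomposition act W U (interSub W U))
    (y : (total act W).toSubmodule) (hy : (y : V) ∈ U) : y ∈ totalSub act W (interSub W U) := by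
  classical
  obtain ⟨f, hf⟩ := (Submodule.mem_iSup_iff_exists_dfinsupp' _ _).1 y.2
  have hy' : (y : V) = ∑ l ∈ f.support, (f l : V) := by rw [← hf, DFinsupp.sum]
  have hmem := fun l (hl : l ∈ f.support) => hA.mem_of_sum_mem_range_evalSum μ hcont hW
    (interSub W U) f.support f (by rw [hR.2, ← hy']; exact hy) hl
  have : y = ∑ l ∈ f.support,
      Submodule.inclusion (le_iSup (fun l => (W l).toSubmodule) l) (f l) := by
    apply Subtype.ext
    rw [hy', AddSubmonoidClass.coe_finsetSum]
    rfl
  rw [this]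
  exact sum_mem fun l hl => Submodule.mem_iSup_of_mem l ⟨f l, hmem l hl, rfl⟩

/-- Equivariant maps `W l ⊗ W m → V` send `U ∩ W l` and `U ∩ W m` into `U`. -/
theorem IsSimple.tprod_apply_mem (hA : A.IsSimple) (μ : Measure G)
    [IsProbabilityMeasure μ] [μ.IsMulLeftInvariant] (hcont : ActsContinuously act)
    (hU : A.IsSubVOA U) (hGU : (rep act).invariants ≤ U) (X Y : Subrepresentation (rep act))
    [FiniteDimensional ℂ X.toSubmodule] [FiniteDimensional ℂ Y.toSubmodule]
    (φ : (X.toRepresentation.tprod Y.toRepresentation).IntertwiningMap (rep act))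
    {x : X.toSubmodule} (hx : (x : V) ∈ U) {y : Y.toSubmodule} (hy : (y : V) ∈ U) :
    φ (x ⊗ₜ y) ∈ U := by
  let j := TensorProduct.map X.toSubmodule.subtype Y.toSubmodule.subtype
  have hj : Function.Injective j := TensorProduct.map_injective_of_flat_flat _ _
    X.toSubmodule.injective_subtype Y.toSubmodule.injective_subtype
  have hβ : ∀ (n : ℤ) g z, (A.modeTensor n ∘ₗ j)
      (X.toRepresentation.tprod Y.toRepresentation g z) =
      rep act g ((A.modeTensor n ∘ₗ j) z) := by
    intro n g z
    induction z with
    | zero => simp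
    | add z z' h h' => rw [map_add, map_add, h, h', map_add, map_add]
    | tmul x y => exact (rep_mode act g x n y).symm
  -- The maps `β n` are indexed by the modes `n`; their joint injectivity is that of `Y`, restricted
  -- along `X ⊗ Y ↪ V ⊗ V`.
  have h := hA.mem_invModeSpan μ hcont hβ (fun z hz => hj <| by
    rw [map_zero]; exact hA.eq_zero_of_modeTensor_eq_zero hz) (φ := φ.toLinearMap)
    φ.isIntertwining
  exact invModeSpan_apply_mem hU hGU h fun n => hU.mode_mem x hx n y hy

/-- `W` may be infinite-dimensional, so `π` is restricted to each `W l ⊗ W m` and viewed as a map to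
`V`. The values lie in `U ∩ W`, whose components lie in the `U ∩ W l`. -/
theorem IsSimple.map_totalSub_le (hA : A.IsSimple) (μ : Measure G)
    [IsProbabilityMeasure μ] [μ.IsMulLeftInvariant] (hcont : ActsContinuously act)
    (hW : IsSystemOfSimples act W) (hU : A.IsSubVOA U) (hGU : (rep act).invariants ≤ U)
    (π : ((total act W).toRepresentation.tprod
      (total act W).toRepresentation).IntertwiningMap (total act W).toRepresentation) :
    (LinearMap.range (TensorProduct.map (totalSub act W (interSub W U)).subtype
      (totalSub act W (interSub W U)).subtype)).map π.toLinearMap ≤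
        totalSub act W (interSub W U) := by
  have hR := hA.isDecomposition_interSub μ hcont hW hU hGU
  let i : ∀ l, (W l).toRepresentation.IntertwiningMap (total act W).toRepresentation := fun l =>
    ⟨Submodule.inclusion (le_iSup (fun l => (W l).toSubmodule) l), fun _ => rfl⟩
  let t : (total act W).toRepresentation.IntertwiningMap (rep act) :=
    ⟨(total act W).toSubmodule.subtype, fun _ => rfl⟩
  have hmem : ∀ r ∈ totalSub act W (interSub W U), ∀ s ∈ totalSub act W (interSub W U),
      π (r ⊗ₜ s) ∈ totalSub act W (interSub W U) := by
    intro r hr s hs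
    induction hr using Submodule.iSup_induction' with
    | zero => rw [TensorProduct.zero_tmul, map_zero]; exact zero_mem _
    | add x y _ _ hx hy => rw [TensorProduct.add_tmul, map_add]; exact add_mem hx hy
    | mem l r hr =>
      induction hs using Submodule.iSup_induction' with
      | zero => rw [TensorProduct.tmul_zero, map_zero]; exact zero_mem _
      | add x y _ _ hx hy => rw [TensorProduct.tmul_add, map_add]; exact add_mem hx hy
      | mem m s hs =>
        obtain ⟨r, hr, rfl⟩ := hr
        obtain ⟨s, hs, rfl⟩ := hs
        have := hW.finiteDimensional l
        have := hW.finiteDimensional m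
        exact hA.mem_totalSub_interSub μ hcont hW hR _
          (hA.tprod_apply_mem μ hcont hU hGU (W l) (W m)
            (t.comp (π.comp ((i l).tensor (i m)))) hr hs)
  rintro _ ⟨_, ⟨z, rfl⟩, rfl⟩
  induction z with
  | zero => simp
  | add z z' h h' => rw [map_add, map_add]; exact add_mem h h'
  | tmul r s => exact hmem r r.2 s s.2

end Compact

end Isotypic

end VOA

theorem proposition2p1 {V : Type*} [AddCommGroup V] [Module ℂ V] (A : VOA V) (hA : A.IsSimple)
    {E : Type*} [NormedAddCommGroup E] [NormedSpace ℝ E] [FiniteDimensional ℝ E]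
    {G : Type*} [Group G] [TopologicalSpace G] [ChartedSpace E G] [LieGroup 𝓘(ℝ, E) ∞ G]
    [CompactSpace G] [T2Space G]
    (act : G →* A.aut) (hact : Function.Injective act) (hcont : VOA.ActsContinuously act)
    {Λ : Type*} (W : Λ → Subrepresentation (VOA.rep act)) (hW : VOA.IsSystemOfSimples act W)
    (U : Submodule ℂ V) (hU : A.IsSubVOA U) (hGU : (VOA.rep act).invariants ≤ U) :
    (∃! R : ∀ l, Submodule ℂ (W l).toSubmodule, VOA.IsDecomposition act W U R) ∧
    ∀ R : ∀ l, Submodule ℂ (W l).toSubmodule, VOA.IsDecomposition act W U R →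
      ∀ π : ((VOA.total act W).toRepresentation.tprod
          (VOA.total act W).toRepresentation).IntertwiningMap (VOA.total act W).toRepresentation,
        (LinearMap.range (TensorProduct.map (VOA.totalSub act W R).subtype
          (VOA.totalSub act W R).subtype)).map π.toLinearMap ≤ VOA.totalSub act W R := by
  have : IsTopologicalGroup G := topologicalGroup_of_lieGroup 𝓘(ℝ, E) ∞
  borelize G
  -- Normalizing Haar measure on the whole compact group makes it a probability measure.
  let μ := MeasureTheory.Measure.haarMeasure (⊤ : TopologicalSpace.PositiveCompacts G)
  have : MeasureTheory.IsProbabilityMeasure μ :=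
    ⟨MeasureTheory.Measure.haarMeasure_self (K₀ := ⊤)⟩
  refine ⟨⟨VOA.interSub W U, hA.isDecomposition_interSub μ hcont hW hU hGU,
    fun R hR => hA.eq_interSub μ hcont hW hR⟩, fun R hR π => ?_⟩
  obtain rfl := hA.eq_interSub μ hcont hW hR
  exact hA.map_totalSub_le μ hcont hW hU hGU π
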